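/- Let $F$ be a field; vector spaces, linear maps and tensor products are over $F$, algebras are unital and associative, coalgebras are counital and coassociative. Let $\Omega$ be a set with two maps $s,t\colon\Omega\to\mathbb Z_{\ge 0}$. An $\Omega$-algebra is a vector space $A$ with a linear map $\omega_A\colon A^{\otimes s(\omega)}\to A^{\otimes t(\omega)}$ for every $\omega\in\Omega$, where $A^{\otimes 0}=F$. Let $A$ and $B$ be $\Omega$-algebras, and let $V$ be a subspace of the space $\mathrm{Vect}_F(A,B)$ of all linear maps $A\to B$. Measurings. For a coalgebra $P$ and a linear map $\psi\colon P\otimes A\to B$ let $\psi_n\colon P\otimes A^{\otimes n}\to B^{\otimes n}$ be given by $\psi_0(p)=\varepsilon(p)$ and $\psi_n(p\otimes a_1\otimes\dots\otimes a_n)=\psi(p_{(1)}\otimes a_1)\otimes\dots\otimes\psi(p_{(n)}\otimes a_n)$ for $n\ge 1$. The map $\psi$ is a measuring if $\psi_{t(\omega)}(p\otimes\omega_A(x))=\omega_B(\psi_{s(\omega)}(p\otimes x))$ for all $\omega\in\Omega$, $p\in P$, $x\in A^{\otimes s(\omega)}$. Its cosupport is $\operatorname{cosupp}\psi=\{\psi(p\otimes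 -)\mid p\in P\}\subseteq\mathrm{Vect}_F(A,B)$. The $V$-universal measuring coalgebra $({}_\square\mathcal C(A,B,V),\psi_{A,B,V})$ is the terminal object of the category of pairs $(P,\psi)$, $\psi\colon P\otimes A\to B$ a measuring with $\operatorname{cosupp}\psi\subseteq V$, whose morphisms $(P_1,\psi_1)\to(P_2,\psi_2)$ are the coalgebra homomorphisms $\varphi\colon P_1\to P_2$ with $\psi_2(\varphi\otimes\mathrm{id}_A)=\psi_1$. Comeasurings. For an algebra $Q$ and a linear map $\rho\colon A\to B\otimes Q$, $\rho(a)=a_{(0)}\otimes a_{(1)}$, let $\rho_n\colon A^{\otimes n}\to B^{\otimes n}\otimes Q$ be given by $\rho_0(\alpha)=\alpha 1_Q$ and $\rho_n(a_1\otimes\dots\otimes a_n)=(a_1)_{(0)}\otimes\dots\otimes(a_n)_{(0)}\otimes(a_1)_{(1)}\cdots(a_n)_{(1)}$ for $n\ge 1$. The map $\rho$ is a comeasuring if $\rho_{t(\omega)}\,\omega_A=(\omega_B\otimes\mathrm{id}_Q)\,\rho_{s(\omega)}$ for all $\omega\in\Omega$. Let $\rho^\vee\colon Q^*\otimes A\to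 B$, $\rho^\vee(q^*\otimes a)=q^*(a_{(1)})a_{(0)}$, and $\operatorname{cosupp}\rho=\{\rho^\vee(q^*\otimes -)\mid q^*\in Q^*\}$. The $V$-universal comeasuring algebra $(\mathcal A^\square(A,B,V),\rho_{A,B,V})$ is the initial object of the category of pairs $(Q,\rho)$, $\rho\colon A\to B\otimes Q$ a comeasuring with $\operatorname{cosupp}\rho\subseteq V$, whose morphisms $(Q_1,\rho_1)\to(Q_2,\rho_2)$ are the unital algebra homomorphisms $\varphi\colon Q_1\to Q_2$ with $(\mathrm{id}_B\otimes\varphi)\rho_1=\rho_2$. The finite dual $Q^\circ$ of an algebra $Q$ is the space of linear functions on $Q$ that vanish on some two-sided ideal of finite codimension; it is a coalgebra with $\varepsilon(f)=f(1)$ and $\Delta f=f_{(1)}\otimes f_{(2)}$ determined by $f(xy)=f_{(1)}(x)f_{(2)}(y)$. The finite topology on $\mathrm{Vect}_F(A,B)$ is generated by the sets $\{f\mid f(a_1)=b_1,\dots,f(a_n)=b_n\}$ with $a_i\in A$, $b_i\in B$. The subspace $V$ is pointwise finite dimensional if $Va=\{va\mid v\in V\}$ is finite dimensional for every $a\in A$.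 **Theorem.** Suppose that $V$ is pointwise finite dimensional and closed in the finite topology. Then ${}_\square\mathcal C(A,B,V)$ and $\mathcal A^\square(A,B,V)$ exist, there is a unique coalgebra homomorphism $\theta\colon\mathcal A^\square(A,B,V)^\circ\to{}_\square\mathcal C(A,B,V)$ such that $\psi_{A,B,V}\circ(\theta\otimes\mathrm{id}_A)$ is the restriction of $\rho_{A,B,V}^\vee$ to $\mathcal A^\square(A,B,V)^\circ\otimes A$, and $\theta$ is an isomorphism of coalgebras. -/

import Mathlib

open scoped TensorProduct

universe u v

noncomputable section

namespace MeasDuality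

section FiniteDual

variable (F : Type*) [Field F] (Q : Type*) [Ring Q] [Algebra F Q]

/-- The finite dual `Q°` of a unital associative algebra `Q`: the linear functions on `Q` that
vanish on some two-sided ideal of finite codimension. -/
def finiteDual : Submodule F (Module.Dual F Q) where
  carrier := {f | ∃ I : Ideal Q, I.IsTwoSided ∧ FiniteDimensional F (Q ⧸ I) ∧ ∀ x ∈ I, f x = 0}
  zero_mem' := by
    refine ⟨⊤, inferInstance, ?_, fun _ _ => rfl⟩
    have : Subsingleton (Q ⧸ (⊤ : Ideal Q)) := Submodule.Quotient.subsingleton_iff.2 rfl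
    infer_instance
  smul_mem' := by
    rintro c f ⟨I, h1, h2, h3⟩
    exact ⟨I, h1, h2, fun x hx => by simp [h3 x hx]⟩
  add_mem' := by
    rintro f g ⟨I, h1, h2, h3⟩ ⟨J, k1, k2, k3⟩
    refine ⟨I ⊓ J, ?_, ?_, fun x hx => by simp [h3 x hx.1, k3 x hx.2]⟩
    · exact ⟨fun b ha => ⟨I.mul_mem_right b ha.1, J.mul_mem_right b ha.2⟩⟩
    · let φ : (Q ⧸ (I ⊓ J)) →ₗ[Q] (Q ⧸ I) × (Q ⧸ J) :=
        (I ⊓ J).liftQ (I.mkQ.prod J.mkQ) (by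
          intro x hx
          exact Prod.ext_iff.2 ⟨(Submodule.Quotient.mk_eq_zero I).2 hx.1,
            (Submodule.Quotient.mk_eq_zero J).2 hx.2⟩)
      refine FiniteDimensional.of_injective (φ.restrictScalars F) ?_
      rw [LinearMap.coe_restrictScalars, ← LinearMap.ker_eq_bot]
      refine Submodule.ker_liftQ_eq_bot _ _ _ ?_
      intro x hx
      have hx' := Prod.ext_iff.1 (LinearMap.mem_ker.1 hx)
      exact ⟨(Submodule.Quotient.mk_eq_zero I).1 hx'.1,
        (Submodule.Quotient.mk_eq_zero J).1 hx'.2⟩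

variable {F Q}

/-- Over a field the canonical map `M* ⊗ N* → (M ⊗ N)*` is injective. -/
theorem dualDistrib_injective (M N : Type*) [AddCommGroup M] [Module F M] [AddCommGroup N]
    [Module F N] : Function.Injective (TensorProduct.dualDistrib F M N) := by
  classical
  refine (injective_iff_map_eq_zero _).2 fun t ht => ?_
  let b := Module.Basis.ofVectorSpace F (Module.Dual F N)
  let e := TensorProduct.equivFinsuppOfBasisRight (M := Module.Dual F M) b
  obtain ⟨c, rfl⟩ := e.symm.surjective t
  suffices c = 0 by simp [this]
  ext i m
  have hsum : ∑ j ∈ c.support, c j m • b j = 0 := by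
    ext n
    have := LinearMap.congr_fun ht (m ⊗ₜ n)
    simpa [e, TensorProduct.equivFinsuppOfBasisRight_symm_apply, Finsupp.sum,
      LinearMap.sum_apply, TensorProduct.dualDistrib_apply] using this
  by_cases hi : i ∈ c.support
  · exact linearIndependent_iff'.1 b.linearIndependent c.support (fun j => c j m) hsum i hi
  · simp [Finsupp.notMem_support_iff.1 hi]

instance finiteDual_free : Module.Free F (finiteDual F Q) := Module.Free.of_divisionRing F (finiteDual F Q)

variable (F Q) in
/-- The canonical map `Q° ⊗ Q° → (Q ⊗ Q)*`, `(f ⊗ g) (x ⊗ y) = f x * g y`. -/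
def finiteDualPair : finiteDual F Q ⊗[F] finiteDual F Q →ₗ[F] Module.Dual F (Q ⊗[F] Q) :=
  TensorProduct.dualDistrib F Q Q ∘ₗ
    TensorProduct.map (finiteDual F Q).subtype (finiteDual F Q).subtype

@[simp]
theorem finiteDualPair_tmul (f g : finiteDual F Q) (x y : Q) :
    finiteDualPair F Q (f ⊗ₜ g) (x ⊗ₜ y) = f.1 x * g.1 y := by
  simp [finiteDualPair]

theorem finiteDualPair_injective : Function.Injective (finiteDualPair F Q) :=
  (dualDistrib_injective Q Q).comp (TensorProduct.map_injective_of_flat_flat _ _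
    (Submodule.subtype_injective _) (Submodule.subtype_injective _))

/-- For `f ∈ Q°`, the function `x ⊗ y ↦ f (x * y)` lies in the image of `Q° ⊗ Q°`. -/
theorem mul_mem_range_finiteDualPair (f : finiteDual F Q) :
    f.1 ∘ₗ LinearMap.mul' F Q ∈ LinearMap.range (finiteDualPair F Q) := by
  obtain ⟨f, I, hI, hfin, hf⟩ := f
  let π : Q →ₗ[F] Q ⧸ I := (Ideal.Quotient.mkₐ F I).toLinearMap
  have hπ : ∀ x y, π (x * y) = π x * π y := fun x y => map_mul (Ideal.Quotient.mkₐ F I) x y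
  have hker : ∀ x, π x = 0 → f x = 0 := fun x hx => hf x (Ideal.Quotient.eq_zero_iff_mem.1 hx)
  let g : Module.Dual F (Q ⧸ I) :=
    ((LinearMap.ker π).liftQ f (fun x hx => hker x hx)) ∘ₗ
      (π.quotKerEquivOfSurjective (Ideal.Quotient.mkₐ_surjective F I)).symm.toLinearMap
  have hg : ∀ x, g (π x) = f x := by
    intro x
    have : (π.quotKerEquivOfSurjective (Ideal.Quotient.mkₐ_surjective F I)).symm (π x) =
        (LinearMap.ker π).mkQ x := by
      rw [LinearEquiv.symm_apply_eq]; rfl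
    simp only [g, LinearMap.comp_apply, LinearEquiv.coe_coe, this]
    exact Submodule.liftQ_apply _ _ _
  let p : Module.Dual F (Q ⧸ I) →ₗ[F] finiteDual F Q :=
    LinearMap.codRestrict (finiteDual F Q) π.dualMap (fun h => ⟨I, hI, hfin, fun x hx => by
      have : π x = 0 := Ideal.Quotient.eq_zero_iff_mem.2 hx
      simp [this]⟩)
  obtain ⟨t, ht⟩ := (TensorProduct.dualDistribEquiv F (Q ⧸ I) (Q ⧸ I)).surjective
    (g ∘ₗ LinearMap.mul' F (Q ⧸ I))
  refine ⟨TensorProduct.map p p t, ?_⟩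
  have key : ∀ t, finiteDualPair F Q (TensorProduct.map p p t) =
      TensorProduct.dualDistrib F _ _ t ∘ₗ TensorProduct.map π π := by
    intro t
    induction t with
    | zero => simp
    | add a b ha hb => simp [ha, hb, LinearMap.add_comp]
    | tmul a b =>
      ext x y
      simp only [TensorProduct.map_tmul, TensorProduct.AlgebraTensorModule.curry_apply,
        LinearMap.restrictScalars_self, TensorProduct.curry_apply, finiteDualPair_tmul,
        LinearMap.comp_apply, TensorProduct.dualDistrib_apply]
      rfl
  rw [key]
  have ht' : TensorProduct.dualDistrib F _ _ t = g ∘ₗ LinearMap.mul' F (Q ⧸ I) := ht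
  rw [ht']
  ext x y
  simp [← hπ, hg]

variable (F Q) in
/-- The comultiplication of `Q°`: the unique `Δ f = ∑ f₁ ⊗ f₂ ∈ Q° ⊗ Q°` such that
`f (x * y) = ∑ f₁ x * f₂ y`. -/
def finiteDualComul : finiteDual F Q →ₗ[F] finiteDual F Q ⊗[F] finiteDual F Q :=
  (LinearEquiv.ofInjective (finiteDualPair F Q) finiteDualPair_injective).symm.toLinearMap ∘ₗ
    LinearMap.codRestrict (LinearMap.range (finiteDualPair F Q))
      ((LinearMap.mul' F Q).dualMap ∘ₗ (finiteDual F Q).subtype) mul_mem_range_finiteDualPair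

theorem finiteDualPair_comul (f : finiteDual F Q) (x y : Q) :
    finiteDualPair F Q (finiteDualComul F Q f) (x ⊗ₜ y) = f.1 (x * y) := by
  have h : finiteDualPair F Q (finiteDualComul F Q f) = f.1 ∘ₗ LinearMap.mul' F Q := by
    have := LinearEquiv.apply_symm_apply
      (LinearEquiv.ofInjective (finiteDualPair F Q) finiteDualPair_injective)
      ⟨_, mul_mem_range_finiteDualPair f⟩
    exact congrArg Subtype.val this
  simp [h]

variable (F Q) in
/-- The counit of `Q°`: `f ↦ f 1`. -/
def finiteDualCounit : finiteDual F Q →ₗ[F] F :=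
  LinearMap.applyₗ (1 : Q) ∘ₗ (finiteDual F Q).subtype

@[simp]
theorem finiteDualCounit_apply (f : finiteDual F Q) : finiteDualCounit F Q f = f.1 1 := rfl

variable (F Q) in
/-- The canonical map `Q° ⊗ (Q° ⊗ Q°) → (Q ⊗ (Q ⊗ Q))*`. -/
def finiteDualPair₃ : finiteDual F Q ⊗[F] (finiteDual F Q ⊗[F] finiteDual F Q) →ₗ[F]
    Module.Dual F (Q ⊗[F] (Q ⊗[F] Q)) :=
  TensorProduct.dualDistrib F Q (Q ⊗[F] Q) ∘ₗ
    TensorProduct.map (finiteDual F Q).subtype (finiteDualPair F Q)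

theorem finiteDualPair₃_injective : Function.Injective (finiteDualPair₃ F Q) :=
  (dualDistrib_injective Q (Q ⊗[F] Q)).comp
    (TensorProduct.map_injective_of_flat_flat _ _ (Submodule.subtype_injective _)
      finiteDualPair_injective)

theorem finiteDualPair₃_rTensor (u : finiteDual F Q ⊗[F] finiteDual F Q) (x y z : Q) :
    finiteDualPair₃ F Q (TensorProduct.assoc F _ _ _ ((finiteDualComul F Q).rTensor _ u))
      (x ⊗ₜ (y ⊗ₜ z)) = finiteDualPair F Q u ((x * y) ⊗ₜ z) := by
  induction u with
  | zero => simp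
  | add a b ha hb => simp only [map_add, LinearMap.add_apply, ha, hb]
  | tmul f g =>
    have aux : ∀ v : finiteDual F Q ⊗[F] finiteDual F Q,
        finiteDualPair₃ F Q (TensorProduct.assoc F _ _ _ (v ⊗ₜ g)) (x ⊗ₜ (y ⊗ₜ z)) =
          finiteDualPair F Q v (x ⊗ₜ y) * g.1 z := by
      intro v
      induction v with
      | zero => simp
      | add a b ha hb => simp only [TensorProduct.add_tmul, map_add, LinearMap.add_apply, ha, hb,
          add_mul]
      | tmul a b => simp [finiteDualPair₃, mul_assoc]
    rw [LinearMap.rTensor_tmul, aux, finiteDualPair_comul, finiteDualPair_tmul]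

theorem finiteDualPair₃_lTensor (u : finiteDual F Q ⊗[F] finiteDual F Q) (x y z : Q) :
    finiteDualPair₃ F Q ((finiteDualComul F Q).lTensor _ u) (x ⊗ₜ (y ⊗ₜ z)) =
      finiteDualPair F Q u (x ⊗ₜ (y * z)) := by
  induction u with
  | zero => simp
  | add a b ha hb => simp only [map_add, LinearMap.add_apply, ha, hb]
  | tmul f g =>
    simp [finiteDualPair₃, finiteDualPair_comul]

/-- The finite dual of an algebra is a coalgebra. -/
instance finiteDualCoalgebra : Coalgebra F (finiteDual F Q) where
  comul := finiteDualComul F Q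
  counit := finiteDualCounit F Q
  coassoc := by
    ext1 f
    apply finiteDualPair₃_injective
    apply TensorProduct.ext
    ext x : 1
    apply TensorProduct.ext
    ext y z
    simp only [LinearMap.comp_apply, TensorProduct.mk_apply,
      LinearEquiv.coe_coe, LinearMap.compr₂ₛₗ_apply]
    rw [finiteDualPair₃_rTensor, finiteDualPair₃_lTensor, finiteDualPair_comul,
      finiteDualPair_comul, mul_assoc]
  rTensor_counit_comp_comul := by
    have aux : ∀ (u : finiteDual F Q ⊗[F] finiteDual F Q) (x : Q),
        (TensorProduct.lid F _ ((finiteDualCounit F Q).rTensor _ u)).1 x =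
          finiteDualPair F Q u (1 ⊗ₜ x) := by
      intro u x
      induction u with
      | zero => simp
      | add a b ha hb => simp only [map_add, LinearMap.add_apply, Submodule.coe_add, ha, hb]
      | tmul f g => simp
    ext1 f
    apply (TensorProduct.lid F (finiteDual F Q)).injective
    ext x
    simp only [LinearMap.comp_apply]
    rw [aux, finiteDualPair_comul]
    simp
  lTensor_counit_comp_comul := by
    have aux : ∀ (u : finiteDual F Q ⊗[F] finiteDual F Q) (x : Q),
        (TensorProduct.rid F _ ((finiteDualCounit F Q).lTensor _ u)).1 x =
          finiteDualPair F Q u (x ⊗ₜ 1) := by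
      intro u x
      induction u with
      | zero => simp
      | add a b ha hb => simp only [map_add, LinearMap.add_apply, Submodule.coe_add, ha, hb]
      | tmul f g => simp [mul_comm]
    ext1 f
    apply (TensorProduct.rid F (finiteDual F Q)).injective
    ext x
    simp only [LinearMap.comp_apply]
    rw [aux, finiteDualPair_comul]
    simp

end FiniteDual

section FiniteTopology

variable (F : Type*) [Field F] (A B : Type*) [AddCommGroup A] [Module F A]
  [AddCommGroup B] [Module F B]

/-- The finite topology on the space of linear maps `A → B`, generated by the sets
`{f | f a₁ = b₁, …, f aₙ = bₙ}`. -/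
@[reducible]
def finiteTopology : TopologicalSpace (A →ₗ[F] B) :=
  TopologicalSpace.generateFrom
    {W | ∃ (n : ℕ) (a : Fin n → A) (b : Fin n → B), W = {f | ∀ i, f (a i) = b i}}

variable {F A B}

/-- `V` is closed in the finite topology. -/
def IsClosedInFiniteTopology (V : Submodule F (A →ₗ[F] B)) : Prop :=
  @IsClosed (A →ₗ[F] B) (finiteTopology F A B) (V : Set (A →ₗ[F] B))

/-- For every `a`, the subspace `V a = {v a | v ∈ V}` of `B` is finite dimensional. -/
def IsPointwiseFiniteDimensional (V : Submodule F (A →ₗ[F] B)) : Prop :=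
  ∀ a : A, FiniteDimensional F (V.map (LinearMap.applyₗ a))

end FiniteTopology

section TensorPowers

/-- The identification `A^{⊗ n} ⊗ A = A^{⊗ (n + 1)}`. -/
def tensorPowerSucc (F : Type*) [Field F] (A : Type*) [AddCommGroup A] [Module F A] (n : ℕ) :
    ⨂[F]^n A ⊗[F] A ≃ₗ[F] ⨂[F]^(n + 1) A :=
  TensorProduct.congr (LinearEquiv.refl F _)
    (PiTensorProduct.subsingletonEquiv (R := F) (s := fun _ : Fin 1 => A) 0).symm ≪≫ₗ
      TensorPower.mulEquiv

end TensorPowers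

/-- An `Ω`-algebra structure on a vector space `A`, for a set `Ω` of operation symbols with
sources `s` and targets `t`: a linear map `A^{⊗ s ω} → A^{⊗ t ω}` for every `ω`. -/
abbrev OmegaStructure (F : Type*) [Field F] {Ω : Type*} (s t : Ω → ℕ)
    (A : Type*) [AddCommGroup A] [Module F A] : Type _ :=
  ∀ ω : Ω, ⨂[F]^(s ω) A →ₗ[F] ⨂[F]^(t ω) A

section Measurings

variable {F : Type*} [Field F] {A B P : Type*} [AddCommGroup A] [Module F A]
  [AddCommGroup B] [Module F B] [AddCommGroup P] [Module F P]

/-- The cosupport of `ψ : P ⊗ A → B`: the space of all maps `ψ (p ⊗ -)`, `p ∈ P`. -/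
def actCosupport (ψ : P ⊗[F] A →ₗ[F] B) : Submodule F (A →ₗ[F] B) :=
  LinearMap.range (TensorProduct.curry ψ)

variable [Coalgebra F P]

/-- The maps `ψₙ : P ⊗ A^{⊗ n} → B^{⊗ n}`,
`ψₙ (p ⊗ a₁ ⊗ ⋯ ⊗ aₙ) = ψ (p₍₁₎ ⊗ a₁) ⊗ ⋯ ⊗ ψ (p₍ₙ₎ ⊗ aₙ)`, with `ψ₀ p = ε p`. -/
def actPower (ψ : P ⊗[F] A →ₗ[F] B) : ∀ n : ℕ, P ⊗[F] ⨂[F]^n A →ₗ[F] ⨂[F]^n B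
  | 0 =>
      (PiTensorProduct.isEmptyEquiv (Fin 0)).symm.toLinearMap ∘ₗ LinearMap.mul' F F ∘ₗ
        TensorProduct.map Coalgebra.counit (PiTensorProduct.isEmptyEquiv (Fin 0)).toLinearMap
  | n + 1 =>
      (tensorPowerSucc F B n).toLinearMap ∘ₗ TensorProduct.map (actPower ψ n) ψ ∘ₗ
        (TensorProduct.tensorTensorTensorComm F P P (⨂[F]^n A) A).toLinearMap ∘ₗ
          TensorProduct.map Coalgebra.comul (tensorPowerSucc F A n).symm.toLinearMap

variable {Ω : Type*} {s t : Ω → ℕ}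

/-- `ψ : P ⊗ A → B` is a measuring between the `Ω`-algebras `A` and `B`:
`ψ_{t ω} (p ⊗ ω_A x) = ω_B (ψ_{s ω} (p ⊗ x))`. -/
def IsMeasuring (ωA : OmegaStructure F s t A) (ωB : OmegaStructure F s t B)
    (ψ : P ⊗[F] A →ₗ[F] B) : Prop :=
  ∀ ω : Ω, actPower ψ (t ω) ∘ₗ (ωA ω).lTensor P = ωB ω ∘ₗ actPower ψ (s ω)

end Measurings

section Comeasurings

variable {F : Type*} [Field F] {A B Q : Type*} [AddCommGroup A] [Module F A]
  [AddCommGroup B] [Module F B]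

/-- The map `ρ^∨ : Q* ⊗ A → B`, `ρ^∨ (q ⊗ a) = q (a₍₁₎) a₍₀₎`, where
`ρ a = a₍₀₎ ⊗ a₍₁₎ ∈ B ⊗ Q`. -/
def coactDual [AddCommGroup Q] [Module F Q] (ρ : A →ₗ[F] B ⊗[F] Q) :
    Module.Dual F Q ⊗[F] A →ₗ[F] B :=
  TensorProduct.rid F B ∘ₗ
    TensorProduct.lift (LinearMap.lcomp F (B ⊗[F] F) ρ ∘ₗ LinearMap.lTensorHom B)

/-- The cosupport of `ρ : A → B ⊗ Q` is the cosupport of `ρ^∨`. -/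
def coactCosupport [AddCommGroup Q] [Module F Q] (ρ : A →ₗ[F] B ⊗[F] Q) :
    Submodule F (A →ₗ[F] B) :=
  actCosupport (coactDual ρ)

variable [Ring Q] [Algebra F Q]

/-- The restriction of `ρ^∨ : Q* ⊗ A → B` to `Q° ⊗ A`. -/
def coactFiniteDual (ρ : A →ₗ[F] B ⊗[F] Q) : finiteDual F Q ⊗[F] A →ₗ[F] B :=
  coactDual ρ ∘ₗ (finiteDual F Q).subtype.rTensor A

/-- The maps `ρₙ : A^{⊗ n} → B^{⊗ n} ⊗ Q`, which send `a₁ ⊗ ⋯ ⊗ aₙ` to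
`(a₁)₍₀₎ ⊗ ⋯ ⊗ (aₙ)₍₀₎ ⊗ (a₁)₍₁₎ ⋯ (aₙ)₍₁₎`, with `ρ₀ α = α 1`. -/
def coactPower (ρ : A →ₗ[F] B ⊗[F] Q) : ∀ n : ℕ, ⨂[F]^n A →ₗ[F] ⨂[F]^n B ⊗[F] Q
  | 0 =>
      TensorProduct.map (PiTensorProduct.isEmptyEquiv (Fin 0)).symm.toLinearMap
          (Algebra.linearMap F Q) ∘ₗ
        TensorProduct.mk F F F 1 ∘ₗ (PiTensorProduct.isEmptyEquiv (Fin 0)).toLinearMap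
  | n + 1 =>
      TensorProduct.map (tensorPowerSucc F B n).toLinearMap (LinearMap.mul' F Q) ∘ₗ
        (TensorProduct.tensorTensorTensorComm F (⨂[F]^n B) Q B Q).toLinearMap ∘ₗ
          TensorProduct.map (coactPower ρ n) ρ ∘ₗ (tensorPowerSucc F A n).symm.toLinearMap

variable {Ω : Type*} {s t : Ω → ℕ}

/-- `ρ : A → B ⊗ Q` is a comeasuring between the `Ω`-algebras `A` and `B`:
`ρ_{t ω} (ω_A x) = (ω_B ⊗ id) (ρ_{s ω} x)`. -/
def IsComeasuring (ωA : OmegaStructure F s t A) (ωB : OmegaStructure F s t B)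
    (ρ : A →ₗ[F] B ⊗[F] Q) : Prop :=
  ∀ ω : Ω, coactPower ρ (t ω) ∘ₗ ωA ω = (ωB ω).rTensor Q ∘ₗ coactPower ρ (s ω)

end Comeasurings

section Universal

variable {F A B : Type u} [Field F] [AddCommGroup A] [Module F A] [AddCommGroup B] [Module F B]
  {Ω : Type v} {s t : Ω → ℕ}

/-- `(C, ψ)` is the `V`-universal measuring coalgebra from `A` to `B`: it is a terminal object of
the category of measurings `P ⊗ A → B` with cosupport in `V`, whose morphisms are the coalgebra
homomorphisms compatible with the measurings. -/
structure IsUniversalMeasuring (ωA : OmegaStructure F s t A) (ωB : OmegaStructure F s t B)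
    (V : Submodule F (A →ₗ[F] B)) {C : Type u} [AddCommGroup C] [Module F C] [Coalgebra F C]
    (ψ : C ⊗[F] A →ₗ[F] B) : Prop where
  isMeasuring : IsMeasuring ωA ωB ψ
  cosupport_le : actCosupport ψ ≤ V
  existsUnique_hom : ∀ (P : Type u) [AddCommGroup P] [Module F P] [Coalgebra F P]
    (ψ' : P ⊗[F] A →ₗ[F] B), IsMeasuring ωA ωB ψ' → actCosupport ψ' ≤ V →
      ∃! φ : P →ₗc[F] C, ψ ∘ₗ φ.toLinearMap.rTensor A = ψ'

/-- `(Q, ρ)` is the `V`-universal comeasuring algebra from `A` to `B`: it is an initial object of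
the category of comeasurings `A → B ⊗ R` with cosupport in `V`, whose morphisms are the unital
algebra homomorphisms compatible with the comeasurings. -/
structure IsUniversalComeasuring (ωA : OmegaStructure F s t A) (ωB : OmegaStructure F s t B)
    (V : Submodule F (A →ₗ[F] B)) {Q : Type u} [Ring Q] [Algebra F Q]
    (ρ : A →ₗ[F] B ⊗[F] Q) : Prop where
  isComeasuring : IsComeasuring ωA ωB ρ
  cosupport_le : coactCosupport ρ ≤ V
  existsUnique_hom : ∀ (R : Type u) [Ring R] [Algebra F R]
    (ρ' : A →ₗ[F] B ⊗[F] R), IsComeasuring ωA ωB ρ' → coactCosupport ρ' ≤ V →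
      ∃! φ : Q →ₐ[F] R, φ.toLinearMap.lTensor B ∘ₗ ρ = ρ'

end Universal

end MeasDuality

end

open MeasDuality

/-! Let `Q` be the universal comeasuring algebra. A measuring `P ⊗ A → B` with cosupport in `V`
should be the same as a comeasuring `A → B ⊗ P*` into the convolution algebra, hence an algebra
homomorphism `Q → P*`, hence by transposition a coalgebra homomorphism `P → Q°`. So `Q°` is a
terminal measuring coalgebra, and `θ`, a morphism of terminal objects, is an isomorphism.

The linear core is the space `Coeff V ⊆ V*` spanned by the functions `v ↦ β (v a)`. Pointwise finite
dimension makes `a ↦ ∑ bᵢ ⊗ [cᵢ ⊗ a]` a finite sum, giving a map `A → B ⊗ Coeff V`; closedness puts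
its cosupport inside `V`. Every map `A → B ⊗ Q` with cosupport in `V` factors through it, so `Q` is
the tensor algebra of `Coeff V` modulo the comeasuring relations (`exists_isUniversalComeasuring`).
The same factorization makes a measuring land in `B ⊗ P*` rather than in the larger space of linear
maps `P → B` (`exists_slice_convPairing_eq`).

All passages between measurings, comeasurings and homomorphisms go through pairings `P → Q*` that
exchange comultiplication with multiplication (`IsDualPairing`): under such a pairing `ψₙ` is a
slice of `ρₙ` (`actPower_tmul_eq_slice`), and its values lie automatically in `Q°`
(`IsDualPairing.apply_mem_finiteDual`). -/

noncomputable section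

namespace MeasDuality

/-! ### Slices of tensors by linear functions on one factor -/

section Slices

variable {F : Type*} [Field F] {M N Q R : Type*} [AddCommGroup M] [Module F M] [AddCommGroup N]
  [Module F N] [AddCommGroup Q] [Module F Q] [AddCommGroup R] [Module F R]

/-- The map `w ↦ id ⊗ w`, for a linear function `w` on the right factor of `M ⊗ Q`. -/
def slice : Module.Dual F Q →ₗ[F] M ⊗[F] Q →ₗ[F] M :=
  LinearMap.llcomp F (M ⊗[F] Q) (M ⊗[F] F) M (TensorProduct.rid F M).toLinearMap ∘ₗ
    LinearMap.lTensorHom M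

/-- The map `β ↦ β ⊗ id`, for a linear function `β` on the left factor of `M ⊗ Q`. -/
def coslice : Module.Dual F M →ₗ[F] M ⊗[F] Q →ₗ[F] Q :=
  LinearMap.llcomp F (M ⊗[F] Q) (F ⊗[F] Q) Q (TensorProduct.lid F Q).toLinearMap ∘ₗ
    LinearMap.rTensorHom Q

@[simp]
theorem slice_tmul (w : Module.Dual F Q) (m : M) (q : Q) : slice w (m ⊗ₜ[F] q) = w q • m := by
  simp [slice]

@[simp]
theorem coslice_tmul (β : Module.Dual F M) (m : M) (q : Q) : coslice β (m ⊗ₜ[F] q) = β m • q := by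
  simp [coslice]

theorem apply_slice (β : Module.Dual F M) (w : Module.Dual F Q) (z : M ⊗[F] Q) :
    β (slice w z) = w (coslice β z) := by
  induction z with
  | zero => simp
  | add a b ha hb => simp only [map_add, ha, hb]
  | tmul m q => simp [mul_comm]

theorem slice_map (w : Module.Dual F R) (g : M →ₗ[F] N) (f : Q →ₗ[F] R) (z : M ⊗[F] Q) :
    slice w (TensorProduct.map g f z) = g (slice (w ∘ₗ f) z) := by
  induction z with
  | zero => simp
  | add a b ha hb => simp only [map_add, ha, hb]
  | tmul m q => simp

theorem coslice_map (β : Module.Dual F N) (g : M →ₗ[F] N) (f : Q →ₗ[F] R) (z : M ⊗[F] Q) :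
    coslice β (TensorProduct.map g f z) = f (coslice (β ∘ₗ g) z) := by
  induction z with
  | zero => simp
  | add a b ha hb => simp only [map_add, ha, hb]
  | tmul m q => simp

theorem slice_lTensor (w : Module.Dual F R) (f : Q →ₗ[F] R) (z : M ⊗[F] Q) :
    slice w (f.lTensor M z) = slice (w ∘ₗ f) z := slice_map w LinearMap.id f z

theorem slice_rTensor (w : Module.Dual F Q) (g : M →ₗ[F] N) (z : M ⊗[F] Q) :
    slice w (g.rTensor Q z) = g (slice w z) := slice_map w g LinearMap.id z

theorem coslice_lTensor (β : Module.Dual F M) (f : Q →ₗ[F] R) (z : M ⊗[F] Q) :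
    coslice β (f.lTensor M z) = f (coslice β z) := coslice_map β LinearMap.id f z

/-- In a basis of `M`, the coordinates of a tensor are its coslices along the coordinate functions.
-/
theorem ext_coslice {z z' : M ⊗[F] Q} (h : ∀ β : Module.Dual F M, coslice β z = coslice β z') :
    z = z' := by
  classical
  let b := Module.Basis.ofVectorSpace F M
  let e := TensorProduct.equivFinsuppOfBasisLeft (N := Q) b
  have key : ∀ (y : M ⊗[F] Q) i, e y i = coslice (b.coord i) y := by
    intro y i
    induction y with
    | zero => simp
    | add a c ha hc => simp only [map_add, Finsupp.add_apply, ha, hc]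
    | tmul m q => simp [e]
  exact e.injective (Finsupp.ext fun i => by rw [key, key, h])

/-- By `apply_slice`, a family separating the points of `Q` separates all coslices, so no basis of
`Q` is needed. -/
theorem ext_slice {P : Type*} {e : P → Module.Dual F Q} (he : ∀ q q', (∀ p, e p q = e p q') → q = q')
    {z z' : M ⊗[F] Q} (h : ∀ p, slice (e p) z = slice (e p) z') : z = z' :=
  ext_coslice fun β => he _ _ fun p => by rw [← apply_slice, ← apply_slice, h]

theorem coactDual_tmul (ρ : M →ₗ[F] N ⊗[F] Q) (w : Module.Dual F Q) (m : M) :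
    coactDual ρ (w ⊗ₜ m) = slice w (ρ m) := by
  simp [coactDual, slice]

theorem slice_dualDistrib (w w' : Module.Dual F Q) (z : M ⊗[F] Q) (z' : N ⊗[F] Q) :
    slice (TensorProduct.dualDistrib F Q Q (w ⊗ₜ w'))
      (TensorProduct.tensorTensorTensorComm F M Q N Q (z ⊗ₜ z')) = slice w z ⊗ₜ slice w' z' := by
  induction z with
  | zero => simp
  | add a b ha hb => simp only [map_add, TensorProduct.add_tmul, ha, hb]
  | tmul m q =>
    induction z' with
    | zero => simp
    | add a b ha hb => simp only [map_add, TensorProduct.tmul_add, ha, hb]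
    | tmul n q' => simp [TensorProduct.smul_tmul', TensorProduct.tmul_smul, smul_smul, mul_comm]

/-- The cosupport of `ρ` is contained in `V` if and only if every map `(id ⊗ w) ∘ ρ` is in `V`. -/
theorem coactCosupport_le_iff {ρ : M →ₗ[F] N ⊗[F] Q} {V : Submodule F (M →ₗ[F] N)} :
    coactCosupport ρ ≤ V ↔ ∀ w : Module.Dual F Q, slice w ∘ₗ ρ ∈ V := by
  have : ∀ w, TensorProduct.curry (coactDual ρ) w = slice w ∘ₗ ρ := fun w =>
    LinearMap.ext fun a => coactDual_tmul ρ w a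
  constructor
  · exact fun h w => h ⟨w, this w⟩
  · rintro h _ ⟨w, rfl⟩
    rw [this]
    exact h w

theorem coactCosupport_lTensor_comp_le {ρ : M →ₗ[F] N ⊗[F] Q} {V : Submodule F (M →ₗ[F] N)}
    (h : coactCosupport ρ ≤ V) (f : Q →ₗ[F] R) : coactCosupport (f.lTensor N ∘ₗ ρ) ≤ V := by
  rw [coactCosupport_le_iff] at h ⊢
  intro w
  convert h (w ∘ₗ f) using 1
  ext a
  simp [slice_lTensor]

end Slices

/-! ### Measurings versus comeasurings under a dual pairing -/

section Powers

variable {F : Type*} [Field F] {A B P Q R : Type*} [AddCommGroup A] [Module F A]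
  [AddCommGroup B] [Module F B] [AddCommGroup P] [Module F P] [Coalgebra F P]
  [Ring Q] [Algebra F Q] [Ring R] [Algebra F R]
  {Ω : Type*} {s t : Ω → ℕ}

/-- A pairing `e` of a coalgebra with an algebra is a bialgebraic pairing if it takes the
comultiplication to the transpose of the multiplication and the counit to evaluation at `1`. -/
structure IsDualPairing (e : P →ₗ[F] Module.Dual F Q) : Prop where
  apply_one : ∀ p, e p 1 = Coalgebra.counit (R := F) p
  apply_mul : ∀ p, e p ∘ₗ LinearMap.mul' F Q =
    TensorProduct.dualDistrib F Q Q (TensorProduct.map e e (Coalgebra.comul (R := F) p))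

/-- Slicing a product in `Q` by `e p` splits along the comultiplication of `p`, exactly as in the
recursion for `ψₙ`. This translates the measuring identities into slices of the comeasuring
identities. -/
theorem actPower_tmul_eq_slice {e : P →ₗ[F] Module.Dual F Q} (he : IsDualPairing e)
    {ψ : P ⊗[F] A →ₗ[F] B} {ρ : A →ₗ[F] B ⊗[F] Q}
    (h : ∀ p a, ψ (p ⊗ₜ a) = slice (e p) (ρ a)) (n : ℕ) (p : P) (x : ⨂[F]^n A) :
    actPower ψ n (p ⊗ₜ x) = slice (e p) (coactPower ρ n x) := by
  -- `p` must vary: the induction hypothesis is applied to the left components of its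
  -- comultiplication.
  induction n generalizing p with
  | zero =>
    simp [actPower, coactPower, Algebra.linearMap_apply, Algebra.algebraMap_eq_smul_one,
      he.apply_one, smul_smul, mul_comm]
  | succ n ih =>
    obtain ⟨y, rfl⟩ := (tensorPowerSucc F A n).surjective x
    induction y with
    | zero => simp
    | add a b ha hb => simp only [map_add, TensorProduct.tmul_add, ha, hb]
    | tmul y a =>
      -- The comultiplication of `p` is replaced by an arbitrary `u`, which can be reduced to pure
      -- tensors.
      have key : ∀ u : P ⊗[F] P, TensorProduct.map (actPower ψ n) ψ
          (TensorProduct.tensorTensorTensorComm F P P (⨂[F]^n A) A (u ⊗ₜ (y ⊗ₜ a))) =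
          slice (TensorProduct.dualDistrib F Q Q (TensorProduct.map e e u))
            (TensorProduct.tensorTensorTensorComm F (⨂[F]^n B) Q B Q
              (coactPower ρ n y ⊗ₜ ρ a)) := by
        intro u
        induction u with
        | zero => simp
        | add a b ha hb => simp only [map_add, TensorProduct.add_tmul, ha, hb, LinearMap.add_apply]
        | tmul p p' => simp only [TensorProduct.map_tmul, slice_dualDistrib, ← h, ← ih,
            TensorProduct.tensorTensorTensorComm_tmul]
      simp only [actPower, coactPower, LinearMap.comp_apply, TensorProduct.map_tmul,
        LinearEquiv.coe_coe, LinearEquiv.symm_apply_apply, slice_map, he.apply_mul, key]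

theorem IsDualPairing.isMeasuring {e : P →ₗ[F] Module.Dual F Q} (he : IsDualPairing e)
    {ψ : P ⊗[F] A →ₗ[F] B} {ρ : A →ₗ[F] B ⊗[F] Q} (h : ∀ p a, ψ (p ⊗ₜ a) = slice (e p) (ρ a))
    {ωA : OmegaStructure F s t A} {ωB : OmegaStructure F s t B} (hρ : IsComeasuring ωA ωB ρ) :
    IsMeasuring ωA ωB ψ := by
  intro ω
  refine TensorProduct.ext' fun p x => ?_
  have := congrArg (slice (e p)) (LinearMap.congr_fun (hρ ω) x)
  simp only [LinearMap.comp_apply, slice_rTensor] at this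
  simpa [actPower_tmul_eq_slice he h] using this

theorem IsDualPairing.isComeasuring {e : P →ₗ[F] Module.Dual F Q} (he : IsDualPairing e)
    (hinj : ∀ q q', (∀ p, e p q = e p q') → q = q')
    {ψ : P ⊗[F] A →ₗ[F] B} {ρ : A →ₗ[F] B ⊗[F] Q} (h : ∀ p a, ψ (p ⊗ₜ a) = slice (e p) (ρ a))
    {ωA : OmegaStructure F s t A} {ωB : OmegaStructure F s t B} (hψ : IsMeasuring ωA ωB ψ) :
    IsComeasuring ωA ωB ρ := by
  intro ω
  refine LinearMap.ext fun x => ext_slice hinj fun p => ?_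
  have := LinearMap.congr_fun (hψ ω) (p ⊗ₜ x)
  simp only [LinearMap.comp_apply, LinearMap.lTensor_tmul, actPower_tmul_eq_slice he h] at this
  simpa [slice_rTensor] using this

theorem coactPower_lTensor (φ : Q →ₐ[F] R) (ρ : A →ₗ[F] B ⊗[F] Q) (n : ℕ) (x : ⨂[F]^n A) :
    coactPower (φ.toLinearMap.lTensor B ∘ₗ ρ) n x =
      φ.toLinearMap.lTensor (⨂[F]^n B) (coactPower ρ n x) := by
  induction n with
  | zero => simp [coactPower]
  | succ n ih =>
    obtain ⟨y, rfl⟩ := (tensorPowerSucc F A n).surjective x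
    induction y with
    | zero => simp
    | add a b ha hb => simp only [map_add, ha, hb]
    | tmul y a =>
      simp only [coactPower, LinearMap.comp_apply, TensorProduct.map_tmul, LinearEquiv.coe_coe,
        LinearEquiv.symm_apply_apply, ih]
      generalize coactPower ρ n y = z
      generalize ρ a = z'
      induction z with
      | zero => simp
      | add a b ha hb => simp only [map_add, TensorProduct.add_tmul, ha, hb]
      | tmul m q =>
        induction z' with
        | zero => simp
        | add a b ha hb => simp only [map_add, TensorProduct.tmul_add, ha, hb]
        | tmul n q' => simp

end Powers

/-! ### Closed subspaces and the universal coefficient space -/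

section FiniteTopology

variable {F : Type*} [Field F] {A B : Type*} [AddCommGroup A] [Module F A]
  [AddCommGroup B] [Module F B] {V : Submodule F (A →ₗ[F] B)}

/-- A linear map that agrees on every finite set with an element of a closed space `V` is in `V`. -/
theorem IsClosedInFiniteTopology.mem_of_forall_finset (hV : IsClosedInFiniteTopology V)
    {h : A →ₗ[F] B} (H : ∀ S : Finset A, ∃ v ∈ V, ∀ a ∈ S, v a = h a) : h ∈ V := by
  classical
  let _ := finiteTopology F A B
  have hb : TopologicalSpace.IsTopologicalBasis {W : Set (A →ₗ[F] B) |
      ∃ (n : ℕ) (a : Fin n → A) (b : Fin n → B), W = {f | ∀ i, f (a i) = b i}} := by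
    -- The generating sets are already stable under finite intersection: concatenate the two lists
    -- of conditions.
    refine TopologicalSpace.isTopologicalBasis_of_subbasis_of_finiteInter rfl ⟨?_, ?_⟩
    · exact ⟨0, Fin.elim0, Fin.elim0, by simp⟩
    · rintro _ ⟨n, a, b, rfl⟩ _ ⟨m, c, d, rfl⟩
      refine ⟨n + m, Fin.append a c, Fin.append b d, Set.ext fun f => ?_⟩
      simp [Fin.forall_fin_add]
  have hcl : IsClosed (V : Set (A →ₗ[F] B)) := hV
  rw [← SetLike.mem_coe, ← hcl.closure_eq, hb.mem_closure_iff]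
  rintro _ ⟨n, a, b, rfl⟩ hab
  obtain ⟨v, hv, hva⟩ := H (Finset.univ.image a)
  exact ⟨v, fun i => (hva _ (by simp)).trans (hab i), hv⟩

/-- The pairing of `B* ⊗ A` with the space `V` of linear maps `A → B`. -/
def evalPairing (V : Submodule F (A →ₗ[F] B)) :
    Module.Dual F B ⊗[F] A →ₗ[F] Module.Dual F V :=
  TensorProduct.lift (LinearMap.mk₂ F
    (fun (β : Module.Dual F B) (a : A) => β ∘ₗ LinearMap.applyₗ a ∘ₗ V.subtype)
    (fun _ _ _ => rfl) (fun _ _ _ => rfl)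
    (fun _ _ _ => by ext; simp) (fun _ _ _ => by ext; simp))

@[simp]
theorem evalPairing_tmul_apply (β : Module.Dual F B) (a : A) (v : V) :
    evalPairing V (β ⊗ₜ a) v = β (v.1 a) := rfl

/-- A linear map `h` is in the closed space `V` if `∑ βᵢ (h aᵢ) = 0` whenever
`∑ βᵢ (v aᵢ) = 0` for all `v ∈ V`. -/
theorem IsClosedInFiniteTopology.mem_of_forall_evalPairing (hV : IsClosedInFiniteTopology V)
    {h : A →ₗ[F] B}
    (H : ∀ x, evalPairing V x = 0 → TensorProduct.lift (h.dualMap) x = 0) : h ∈ V := by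
  classical
  refine hV.mem_of_forall_finset fun S => ?_
  let r : (A →ₗ[F] B) →ₗ[F] (S → B) := LinearMap.pi fun a => LinearMap.applyₗ a.1
  suffices r h ∈ V.map r by
    obtain ⟨v, hv, hvr⟩ := this
    exact ⟨v, hv, fun a ha => congrFun hvr ⟨a, ha⟩⟩
  -- In `S → B` a vector outside a subspace is separated from it by a linear function `γ`; its
  -- components, paired with the points of `S`, form an element of `B* ⊗ A` that kills `V` but not
  -- `h`.
  by_contra hn
  obtain ⟨γ, hγ, hγV⟩ := Submodule.exists_le_ker_of_notMem hn
  refine hγ ?_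
  have hs : ∀ g : A →ₗ[F] B, γ (r g) =
      ∑ a : S, (γ ∘ₗ LinearMap.single F (fun _ : S => B) a) (g a.1) := by
    intro g
    simp only [LinearMap.comp_apply, ← map_sum]
    congr 1
    ext a
    simp [r, Finset.sum_apply, Pi.single_apply]
  have := H (∑ a : S, (γ ∘ₗ LinearMap.single F (fun _ : S => B) a) ⊗ₜ a.1) (by
    ext v
    simp only [map_sum, LinearMap.sum_apply, evalPairing_tmul_apply, ← hs, LinearMap.zero_apply]
    exact hγV ⟨v.1, v.2, rfl⟩)
  rw [hs]
  simpa using this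

/-- The space of linear functions on `V` spanned by the functions `v ↦ β (v a)`. It is the
space of coefficients of the universal map `A → B ⊗ W` with cosupport in `V`. -/
def Coeff (V : Submodule F (A →ₗ[F] B)) : Type _ :=
  LinearMap.range (evalPairing V)

instance Coeff.addCommGroup : AddCommGroup (Coeff V) :=
  Submodule.addCommGroup (LinearMap.range (evalPairing V))

instance Coeff.module : Module F (Coeff V) :=
  Submodule.module (LinearMap.range (evalPairing V))

/-- The quotient map from `B* ⊗ A` to the space of coefficients. -/
def Coeff.proj (V : Submodule F (A →ₗ[F] B)) : Module.Dual F B ⊗[F] A →ₗ[F] Coeff V :=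
  (evalPairing V).rangeRestrict

theorem Coeff.proj_surjective : Function.Surjective (Coeff.proj V) :=
  (evalPairing V).surjective_rangeRestrict

theorem Coeff.proj_eq_iff {x y : Module.Dual F B ⊗[F] A} :
    Coeff.proj V x = Coeff.proj V y ↔ ∀ v : V, evalPairing V x v = evalPairing V y v :=
  Subtype.ext_iff.trans LinearMap.ext_iff

/-- The class of `β ⊗ a` in the space of coefficients. -/
def Coeff.mk (V : Submodule F (A →ₗ[F] B)) (β : Module.Dual F B) (a : A) : Coeff V :=
  Coeff.proj V (β ⊗ₜ a)

/-- With a finite basis `bᵢ` of `V a` and extensions `cᵢ` of its coordinates to `B`, every `v ∈ V`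
satisfies `v a = ∑ cᵢ (v a) bᵢ`. Hence `β ⊗ a` and `∑ β bᵢ • (cᵢ ⊗ a)` agree on `V`. -/
theorem exists_coeffCoact_apply (hV : IsPointwiseFiniteDimensional V) (a : A) :
    ∃ z : B ⊗[F] Coeff V, ∀ β, coslice β z = Coeff.mk V β a := by
  classical
  let U := V.map (LinearMap.applyₗ a)
  have : FiniteDimensional F U := hV a
  let b := Module.finBasis F U
  obtain ⟨π, hπ⟩ := U.subtype.exists_leftInverse_of_injective U.ker_subtype
  let c (i) : Module.Dual F B := b.coord i ∘ₗ π
  refine ⟨∑ i, (b i : B) ⊗ₜ Coeff.mk V (c i) a, fun β => ?_⟩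
  have h1 : Coeff.proj V (∑ i, β (b i) • (c i ⊗ₜ a)) = Coeff.proj V (β ⊗ₜ a) := by
    refine Coeff.proj_eq_iff.2 fun v => ?_
    have hva : v.1 a ∈ U := ⟨v.1, v.2, rfl⟩
    have hπv : π (v.1 a) = ⟨v.1 a, hva⟩ := LinearMap.congr_fun hπ ⟨v.1 a, hva⟩
    have h2 : ∑ i, c i (v.1 a) • (b i : B) = v.1 a := by
      have := congrArg Subtype.val (b.sum_repr ⟨v.1 a, hva⟩)
      simpa only [c, LinearMap.comp_apply, hπv, Module.Basis.coord_apply, Submodule.coe_sum,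
        Submodule.coe_smul] using this
    rw [evalPairing_tmul_apply, ← h2, map_sum, map_sum, LinearMap.sum_apply]
    refine Finset.sum_congr rfl fun i _ => ?_
    rw [map_smul, map_smul, LinearMap.smul_apply, evalPairing_tmul_apply, smul_eq_mul, smul_eq_mul,
      mul_comm]
  rw [map_sum, Coeff.mk, ← h1, map_sum]
  exact Finset.sum_congr rfl fun i _ => by rw [coslice_tmul, map_smul, Coeff.mk]

/-- The universal linear map `A → B ⊗ W` with cosupport in `V`. -/
def coeffCoact (hV : IsPointwiseFiniteDimensional V) : A →ₗ[F] B ⊗[F] Coeff V where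
  toFun a := (exists_coeffCoact_apply hV a).choose
  map_add' a a' := ext_coslice fun β => by
    rw [map_add, (exists_coeffCoact_apply hV _).choose_spec,
      (exists_coeffCoact_apply hV _).choose_spec, (exists_coeffCoact_apply hV _).choose_spec]
    simp [Coeff.mk, TensorProduct.tmul_add]
  map_smul' c a := ext_coslice fun β => by
    rw [map_smul, (exists_coeffCoact_apply hV _).choose_spec,
      (exists_coeffCoact_apply hV _).choose_spec]
    simp [Coeff.mk]

@[simp]
theorem coslice_coeffCoact (hV : IsPointwiseFiniteDimensional V) (β : Module.Dual F B) (a : A) :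
    coslice β (coeffCoact hV a) = Coeff.mk V β a :=
  (exists_coeffCoact_apply hV a).choose_spec β

/-- The slice by `w` pairs with `x ∈ B* ⊗ A` to give `w` of the class of `x`, which is zero whenever
`x` annihilates `V`. Closedness then puts the slice in `V`. -/
theorem coactCosupport_coeffCoact_le (hV : IsPointwiseFiniteDimensional V)
    (hc : IsClosedInFiniteTopology V) : coactCosupport (coeffCoact hV) ≤ V := by
  refine coactCosupport_le_iff.2 fun w => hc.mem_of_forall_evalPairing fun x hx => ?_
  have : TensorProduct.lift (slice w ∘ₗ coeffCoact hV).dualMap =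
      w ∘ₗ Coeff.proj V := by
    refine TensorProduct.ext' fun β a => ?_
    simp [apply_slice, Coeff.mk]
  have h0 : Coeff.proj V x = Coeff.proj V 0 := Coeff.proj_eq_iff.2 fun v => by rw [hx, map_zero]
  rw [this, LinearMap.comp_apply, h0, map_zero, map_zero]

/-- Linear maps from the space of coefficients that agree with the universal map are equal. -/
theorem Coeff.hom_ext {Q : Type*} [AddCommGroup Q] [Module F Q] {f g : Coeff V →ₗ[F] Q}
    (h : ∀ β a, f (Coeff.mk V β a) = g (Coeff.mk V β a)) : f = g :=
  (LinearMap.cancel_right Coeff.proj_surjective).1 (TensorProduct.ext' h)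

/-- A bilinear map that takes equal values on tensors that agree on `V` factors through the space
of coefficients. -/
theorem Coeff.exists_lift {Q : Type*} [AddCommGroup Q] [Module F Q] {P : Type*}
    (k : Module.Dual F B →ₗ[F] A →ₗ[F] Q) (e : P → Module.Dual F Q)
    (he : ∀ q, (∀ p, e p q = 0) → q = 0) (ψ : P → A →ₗ[F] B) (hψ : ∀ p, ψ p ∈ V)
    (hk : ∀ p β a, e p (k β a) = β (ψ p a)) :
    ∃ f : Coeff V →ₗ[F] Q, ∀ β a, f (Coeff.mk V β a) = k β a := by
  obtain ⟨σ, hσ⟩ := (Coeff.proj V).exists_rightInverse_of_surjective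
    (LinearMap.range_eq_top.2 Coeff.proj_surjective)
  -- The choice of the section `σ` is harmless: tensors with the same class pair equally with every
  -- `ψ p ∈ V`, so their images under `k` cannot be told apart by the separating family `e`.
  refine ⟨TensorProduct.lift k ∘ₗ σ, fun β a => ?_⟩
  have hx := Coeff.proj_eq_iff.1 (LinearMap.congr_fun hσ (Coeff.mk V β a))
  have h (p : P) (x) : e p (TensorProduct.lift k x) = evalPairing V x ⟨ψ p, hψ p⟩ := by
    induction x with
    | zero => simp
    | add x y hx hy => simp only [map_add, LinearMap.add_apply, hx, hy]
    | tmul β a => simp [hk]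
  rw [← sub_eq_zero]
  refine he _ fun p => ?_
  rw [map_sub, sub_eq_zero, LinearMap.comp_apply, h, hx, evalPairing_tmul_apply, hk]

/-- Every linear map `A → B ⊗ Q` with cosupport in `V` factors through the universal one. -/
theorem exists_lTensor_comp_coeffCoact (hV : IsPointwiseFiniteDimensional V) {Q : Type*}
    [AddCommGroup Q] [Module F Q] {ρ : A →ₗ[F] B ⊗[F] Q} (hρ : coactCosupport ρ ≤ V) :
    ∃ f : Coeff V →ₗ[F] Q, f.lTensor B ∘ₗ coeffCoact hV = ρ := by
  -- The separating family is all of `Q*`, and the matching elements of `V` are the slices of `ρ`.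
  obtain ⟨f, hf⟩ := Coeff.exists_lift (V := V) (LinearMap.lcomp F Q ρ ∘ₗ coslice)
    (fun w : Module.Dual F Q => w) (fun q => (Module.forall_dual_apply_eq_zero_iff F q).1)
    (fun w => slice w ∘ₗ ρ) (coactCosupport_le_iff.1 hρ) (fun w β a => by simp [apply_slice])
  refine ⟨f, LinearMap.ext fun a => ext_coslice fun β => ?_⟩
  simp [coslice_lTensor, hf]

end FiniteTopology

/-! ### The universal comeasuring algebra -/

section UniversalComeasuring

variable {F : Type*} [Field F] {A B Q R : Type*} [AddCommGroup A] [Module F A]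
  [AddCommGroup B] [Module F B] [Ring Q] [Algebra F Q] [Ring R] [Algebra F R]
  {Ω : Type*} {s t : Ω → ℕ} (ωA : OmegaStructure F s t A) (ωB : OmegaStructure F s t B)

/-- The relations that have to hold in a quotient of `Q` for `ρ` to become a comeasuring. -/
def ComeasuringRel (ρ : A →ₗ[F] B ⊗[F] Q) (x y : Q) : Prop :=
  ∃ (ω : Ω) (z : ⨂[F]^(s ω) A) (γ : Module.Dual F (⨂[F]^(t ω) B)),
    x = coslice γ (coactPower ρ (t ω) (ωA ω z)) ∧
      y = coslice γ ((ωB ω).rTensor Q (coactPower ρ (s ω) z))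

variable {ωA ωB}

/-- Both sides of the comeasuring identity for `(id ⊗ φ) ρ` are images under `id ⊗ φ` of those for
`ρ`, and coslices detect equality. This is why the quotient by `ComeasuringRel` is universal. -/
theorem isComeasuring_lTensor_comp_iff {φ : Q →ₐ[F] R} {ρ : A →ₗ[F] B ⊗[F] Q} :
    IsComeasuring ωA ωB (φ.toLinearMap.lTensor B ∘ₗ ρ) ↔
      ∀ ⦃x y⦄, ComeasuringRel ωA ωB ρ x y → φ x = φ y := by
  have h (ω : Ω) (z) : (ωB ω).rTensor R
      (coactPower (φ.toLinearMap.lTensor B ∘ₗ ρ) (s ω) z) =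
      φ.toLinearMap.lTensor _ ((ωB ω).rTensor Q (coactPower ρ (s ω) z)) := by
    rw [coactPower_lTensor, ← LinearMap.comp_apply, LinearMap.rTensor_comp_lTensor,
      ← LinearMap.lTensor_comp_rTensor, LinearMap.comp_apply]
  constructor
  · rintro hc _ _ ⟨ω, z, γ, rfl, rfl⟩
    have := congrArg (coslice γ) (LinearMap.congr_fun (hc ω) z)
    rwa [LinearMap.comp_apply, LinearMap.comp_apply, h, coactPower_lTensor, coslice_lTensor,
      coslice_lTensor] at this
  · refine fun H ω => LinearMap.ext fun z => ext_coslice fun γ => ?_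
    rw [LinearMap.comp_apply, LinearMap.comp_apply, h, coactPower_lTensor, coslice_lTensor,
      coslice_lTensor]
    exact H ⟨ω, z, γ, rfl, rfl⟩

end UniversalComeasuring

section ExistsUniversalComeasuring

variable {F A B : Type u} [Field F] [AddCommGroup A] [Module F A] [AddCommGroup B] [Module F B]
  {Ω : Type v} {s t : Ω → ℕ}

/-- If `V` is pointwise finite dimensional and closed, the `V`-universal comeasuring algebra
exists: it is the quotient of the tensor algebra of the space of coefficients by the relations of
a comeasuring. -/
theorem exists_isUniversalComeasuring (ωA : OmegaStructure F s t A) (ωB : OmegaStructure F s t B)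
    {V : Submodule F (A →ₗ[F] B)} (hV : IsPointwiseFiniteDimensional V)
    (hc : IsClosedInFiniteTopology V) :
    ∃ (Q : Type u) (_ : Ring Q) (_ : Algebra F Q) (ρ : A →ₗ[F] B ⊗[F] Q),
      IsUniversalComeasuring ωA ωB V ρ := by
  let ρ₀ : A →ₗ[F] B ⊗[F] TensorAlgebra F (Coeff V) :=
    (TensorAlgebra.ι F).lTensor B ∘ₗ coeffCoact hV
  let r := ComeasuringRel ωA ωB ρ₀
  let π : TensorAlgebra F (Coeff V) →ₐ[F] RingQuot r := RingQuot.mkAlgHom F r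
  refine ⟨RingQuot r, inferInstance, inferInstance, π.toLinearMap.lTensor B ∘ₗ ρ₀, ?_, ?_, ?_⟩
  · exact isComeasuring_lTensor_comp_iff.2 fun x y h => RingQuot.mkAlgHom_rel F h
  · exact coactCosupport_lTensor_comp_le
      (coactCosupport_lTensor_comp_le (coactCosupport_coeffCoact_le hV hc) _) _
  · intro R _ _ ρ' hρ' hle
    have hπ (φ : RingQuot r →ₐ[F] R) :
        φ.toLinearMap.lTensor B ∘ₗ π.toLinearMap.lTensor B ∘ₗ ρ₀ =
          (φ.comp π).toLinearMap.lTensor B ∘ₗ ρ₀ := by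
      rw [← LinearMap.comp_assoc, ← LinearMap.lTensor_comp]
      rfl
    obtain ⟨f, rfl⟩ := exists_lTensor_comp_coeffCoact hV hle
    have hf : (TensorAlgebra.lift F f).toLinearMap.lTensor B ∘ₗ ρ₀ =
        f.lTensor B ∘ₗ coeffCoact hV := by
      rw [← LinearMap.comp_assoc, ← LinearMap.lTensor_comp]
      congr 2
      ext x
      simp
    rw [← hf] at hρ' ⊢
    refine ⟨RingQuot.liftAlgHom F ⟨TensorAlgebra.lift F f,
      isComeasuring_lTensor_comp_iff.1 hρ'⟩, ?_, fun φ hφ => ?_⟩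
    · beta_reduce
      rw [hπ]
      congr 2
      ext x
      simp [π]
    -- Uniqueness: the classes `Coeff.mk V β a` generate the algebra, and their images are coslices
    -- of the prescribed map.
    · refine RingQuot.ringQuot_ext' _ _ _ (TensorAlgebra.hom_ext (Coeff.hom_ext fun β a => ?_))
      beta_reduce at hφ
      rw [hπ] at hφ
      have := congrArg (coslice β) (LinearMap.congr_fun hφ a)
      simpa [ρ₀, coslice_lTensor, π] using this

end ExistsUniversalComeasuring

/-! ### Dual pairings as maps to the finite dual and to the convolution algebra -/

section DualPairings

variable {F : Type*} [Field F] {P Q R : Type*} [AddCommGroup P] [Module F P]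
  [Ring Q] [Algebra F Q] [Ring R] [Algebra F R]

/-- A tensor is a finite sum of pure tensors, and `S` collects their entries. This supplies the
finiteness behind `IsDualPairing.apply_mem_finiteDual`. -/
theorem exists_finset_dualDistrib_eq_zero (e : P →ₗ[F] Module.Dual F Q) (u : P ⊗[F] P) :
    ∃ S : Finset P, ∀ x y, (∀ v ∈ S, e v x = 0) ∨ (∀ v ∈ S, e v y = 0) →
      TensorProduct.dualDistrib F Q Q (TensorProduct.map e e u) (x ⊗ₜ y) = 0 := by
  classical
  induction u with
  | zero => exact ⟨∅, by simp⟩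
  | tmul p p' =>
    refine ⟨{p, p'}, fun x y h => ?_⟩
    rcases h with h | h <;> simp [h]
  | add a b ha hb =>
    obtain ⟨S, hS⟩ := ha
    obtain ⟨T, hT⟩ := hb
    refine ⟨S ∪ T, fun x y h => ?_⟩
    rw [map_add, map_add, LinearMap.add_apply, hS, hT, add_zero]
    · exact h.imp (fun h v hv => h v (Finset.mem_union_right _ hv))
        (fun h v hv => h v (Finset.mem_union_right _ hv))
    · exact h.imp (fun h v hv => h v (Finset.mem_union_left _ hv))
        (fun h v hv => h v (Finset.mem_union_left _ hv))

variable (F P) in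
/-- The pairing of a vector space, in practice a coalgebra, with its dual. -/
def convPairing : P →ₗ[F] Module.Dual F (WithConv (P →ₗ[F] F)) :=
  (WithConv.linearEquiv F (P →ₗ[F] F)).toLinearMap.dualMap ∘ₗ Module.Dual.eval F P

@[simp]
theorem convPairing_apply (p : P) (f : WithConv (P →ₗ[F] F)) :
    convPairing F P p f = f.ofConv p := rfl

theorem dualDistrib_map_convPairing (f g : WithConv (P →ₗ[F] F)) (u : P ⊗[F] P) :
    TensorProduct.dualDistrib F _ _ (TensorProduct.map (convPairing F P) (convPairing F P) u)
      (f ⊗ₜ g) = LinearMap.mul' F F (TensorProduct.map f.ofConv g.ofConv u) := by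
  induction u with
  | zero => simp
  | add a b ha hb => simp only [map_add, LinearMap.add_apply, ha, hb]
  | tmul a b => simp

variable [Coalgebra F P]

theorem IsDualPairing.apply_mul_apply {e : P →ₗ[F] Module.Dual F Q} (he : IsDualPairing e)
    (p : P) (x y : Q) : e p (x * y) =
      TensorProduct.dualDistrib F Q Q
        (TensorProduct.map e e (Coalgebra.comul (R := F) p)) (x ⊗ₜ y) := by
  rw [← he.apply_mul]
  simp

theorem isDualPairing_subtype : IsDualPairing (P := finiteDual F Q) (finiteDual F Q).subtype where
  apply_one _ := rfl
  apply_mul f := TensorProduct.ext' fun x y => by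
    rw [LinearMap.comp_apply, LinearMap.mul'_apply]
    exact (finiteDualPair_comul f x y).symm

theorem IsDualPairing.comp_coalgHom {P' : Type*} [AddCommGroup P'] [Module F P'] [Coalgebra F P']
    {e : P →ₗ[F] Module.Dual F Q} (he : IsDualPairing e) (φ : P' →ₗc[F] P) :
    IsDualPairing (e ∘ₗ φ.toLinearMap) where
  apply_one p := by simp [he.apply_one]
  apply_mul p := by
    rw [TensorProduct.map_comp, LinearMap.comp_apply, LinearMap.comp_apply, he.apply_mul]
    congr 2
    exact (CoalgHomClass.map_comp_comul_apply φ p).symm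

theorem IsDualPairing.comp_algHom {e : P →ₗ[F] Module.Dual F Q} (he : IsDualPairing e)
    (φ : R →ₐ[F] Q) : IsDualPairing (φ.toLinearMap.dualMap ∘ₗ e) where
  apply_one p := by simp [he.apply_one]
  apply_mul p := TensorProduct.ext' fun x y => by
    have h : ∀ u : P ⊗[F] P, TensorProduct.dualDistrib F Q Q (TensorProduct.map e e u)
        (φ x ⊗ₜ φ y) = TensorProduct.dualDistrib F R R (TensorProduct.map
          (φ.toLinearMap.dualMap ∘ₗ e) (φ.toLinearMap.dualMap ∘ₗ e) u) (x ⊗ₜ y) := by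
      intro u
      induction u with
      | zero => simp
      | add a b ha hb => simp only [map_add, LinearMap.add_apply, ha, hb]
      | tmul a b => simp
    simp [← h, he.apply_mul_apply]

/-- The functions given by a pairing of a coalgebra with `Q` are in the finite dual of `Q`. -/
theorem IsDualPairing.apply_mem_finiteDual {e : P →ₗ[F] Module.Dual F Q} (he : IsDualPairing e)
    (p : P) : e p ∈ finiteDual F Q := by
  classical
  choose S hS using fun p => exists_finset_dualDistrib_eq_zero e (Coalgebra.comul (R := F) p)
  -- Two comultiplications are needed to isolate `q` in `e p (x * (q * y))`, so `T` gathers the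
  -- entries at the second level.
  let T := (S p).biUnion S
  let I : Ideal Q :=
    { carrier := {q | ∀ x y, e p (x * (q * y)) = 0}
      zero_mem' := by simp
      add_mem' := fun {a b} ha hb x y => by rw [add_mul, mul_add, map_add, ha, hb, add_zero]
      smul_mem' := fun c q hq x y => by
        rw [smul_eq_mul, mul_assoc, ← mul_assoc]
        exact hq _ _ }
  have hT : ∀ q, (∀ v ∈ T, e v q = 0) → q ∈ I := by
    intro q hq x y
    rw [he.apply_mul_apply]
    refine hS p _ _ (Or.inr fun v hv => ?_)
    rw [he.apply_mul_apply]
    exact hS v _ _ (Or.inl fun w hw => hq w (Finset.mem_biUnion.2 ⟨v, hv, hw⟩))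
  refine ⟨I, ⟨fun b hq x y => by rw [mul_assoc]; exact hq _ _⟩, ?_, fun q hq => ?_⟩
  -- The common kernel of the finitely many `e v`, `v ∈ T`, has finite codimension and lies in `I`.
  · let g : Q →ₗ[F] (T → F) := LinearMap.pi fun v => e v.1
    let π : Q →ₗ[F] Q ⧸ I := I.mkQ.restrictScalars F
    have hπ : LinearMap.ker g ≤ LinearMap.ker π := fun q hq =>
      (Submodule.Quotient.mk_eq_zero I).2 (hT q fun v hv => congrFun hq ⟨v, hv⟩)
    have : Module.Finite F (Q ⧸ LinearMap.ker g) :=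
      Module.Finite.equiv g.quotKerEquivRange.symm
    refine Module.Finite.of_surjective ((LinearMap.ker g).liftQ π hπ) fun x => ?_
    obtain ⟨q, rfl⟩ := I.mkQ_surjective x
    exact ⟨(LinearMap.ker g).mkQ q, rfl⟩
  · simpa using hq 1 1

/-- A pairing of a coalgebra with `Q`, as a coalgebra homomorphism to the finite dual of `Q`. -/
def IsDualPairing.toCoalgHom {e : P →ₗ[F] Module.Dual F Q} (he : IsDualPairing e) :
    P →ₗc[F] finiteDual F Q where
  toLinearMap := e.codRestrict (finiteDual F Q) he.apply_mem_finiteDual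
  counit_comp := LinearMap.ext he.apply_one
  map_comp_comul := by
    refine LinearMap.ext fun p => finiteDualPair_injective (TensorProduct.ext' fun x y => ?_)
    have h : finiteDualPair F Q ∘ₗ TensorProduct.map
        (e.codRestrict (finiteDual F Q) he.apply_mem_finiteDual)
        (e.codRestrict (finiteDual F Q) he.apply_mem_finiteDual) =
        TensorProduct.dualDistrib F Q Q ∘ₗ TensorProduct.map e e := by
      rw [finiteDualPair, LinearMap.comp_assoc, ← TensorProduct.map_comp,
        LinearMap.subtype_comp_codRestrict]
    have h' := LinearMap.congr_fun h (Coalgebra.comul (R := F) p)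
    rw [LinearMap.comp_apply, LinearMap.comp_apply] at h'
    rw [LinearMap.comp_apply, h', LinearMap.comp_apply, ← he.apply_mul_apply]
    exact (finiteDualPair_comul (F := F) (Q := Q) ⟨e p, he.apply_mem_finiteDual p⟩ x y).symm

theorem isDualPairing_convPairing : IsDualPairing (convPairing F P) where
  apply_one _ := rfl
  apply_mul p := TensorProduct.ext' fun f g => by
    rw [dualDistrib_map_convPairing]
    rfl

/-- A pairing of a coalgebra `P` with `Q`, as a homomorphism from `Q` to the convolution algebra
of `P`. -/
def IsDualPairing.toAlgHom {e : P →ₗ[F] Module.Dual F Q} (he : IsDualPairing e) :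
    Q →ₐ[F] WithConv (P →ₗ[F] F) :=
  AlgHom.ofLinearMap ((WithConv.linearEquiv F (P →ₗ[F] F)).symm.toLinearMap ∘ₗ e.flip)
    (WithConv.ext (LinearMap.ext he.apply_one))
    (fun x y => WithConv.ext (LinearMap.ext fun p => by
      refine (he.apply_mul_apply p x y).trans ?_
      change _ = LinearMap.mul' F F (TensorProduct.map (e.flip x) (e.flip y)
        (Coalgebra.comul (R := F) p))
      generalize Coalgebra.comul (R := F) p = u
      induction u with
      | zero => simp
      | add a b ha hb => simp only [map_add, LinearMap.add_apply, ha, hb]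
      | tmul a b => simp))

end DualPairings

/-! ### The finite dual as universal measuring coalgebra -/

section FiniteDualUniversal

variable {F A B : Type u} [Field F] [AddCommGroup A] [Module F A] [AddCommGroup B] [Module F B]
  {Ω : Type v} {s t : Ω → ℕ} {ωA : OmegaStructure F s t A} {ωB : OmegaStructure F s t B}
  {V : Submodule F (A →ₗ[F] B)}

theorem coactFiniteDual_tmul {Q : Type*} [Ring Q] [Algebra F Q] (ρ : A →ₗ[F] B ⊗[F] Q)
    (f : finiteDual F Q) (a : A) : coactFiniteDual ρ (f ⊗ₜ a) = slice f.1 (ρ a) := by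
  simp [coactFiniteDual, coactDual_tmul]

theorem IsComeasuring.isMeasuring_coactFiniteDual {Q : Type*} [Ring Q] [Algebra F Q]
    {ρ : A →ₗ[F] B ⊗[F] Q} (h : IsComeasuring ωA ωB ρ) :
    IsMeasuring (P := finiteDual F Q) ωA ωB (coactFiniteDual ρ) :=
  IsDualPairing.isMeasuring (P := finiteDual F Q) (e := (finiteDual F Q).subtype)
    isDualPairing_subtype (coactFiniteDual_tmul ρ) h

/-- Every linear map `P ⊗ A → B` with cosupport in `V` comes from a linear map from `A` to
`B ⊗ P*` with cosupport in `V`. -/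
theorem exists_slice_convPairing_eq (hV : IsPointwiseFiniteDimensional V)
    (hc : IsClosedInFiniteTopology V) {P : Type*} [AddCommGroup P] [Module F P] [Coalgebra F P]
    {ψ : P ⊗[F] A →ₗ[F] B} (hψ : actCosupport ψ ≤ V) :
    ∃ ρ : A →ₗ[F] B ⊗[F] WithConv (P →ₗ[F] F), coactCosupport ρ ≤ V ∧
      ∀ p a, ψ (p ⊗ₜ a) = slice (convPairing F P p) (ρ a) := by
  -- `k β a` is the function `p ↦ β (ψ (p ⊗ a))`; since each `ψ (p ⊗ -)` is in `V`, it factors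
  -- through `Coeff V`.
  let k : Module.Dual F B →ₗ[F] A →ₗ[F] WithConv (P →ₗ[F] F) :=
    LinearMap.mk₂ F (fun β a => WithConv.toConv (β ∘ₗ (TensorProduct.curry ψ).flip a))
      (fun _ _ _ => rfl) (fun _ _ _ => rfl)
      (fun _ _ _ => WithConv.ext (by ext; simp)) (fun _ _ _ => WithConv.ext (by ext; simp))
  obtain ⟨f, hf⟩ := Coeff.exists_lift (V := V) k (convPairing F P)
    (fun q h => WithConv.ext (LinearMap.ext h)) (TensorProduct.curry ψ) (fun p => hψ ⟨p, rfl⟩)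
    (fun p β a => rfl)
  refine ⟨f.lTensor B ∘ₗ coeffCoact hV,
    coactCosupport_lTensor_comp_le (coactCosupport_coeffCoact_le hV hc) f, fun p a => ?_⟩
  rw [← sub_eq_zero, ← Module.forall_dual_apply_eq_zero_iff F]
  intro β
  rw [map_sub, sub_eq_zero, apply_slice, LinearMap.comp_apply, coslice_lTensor,
    coslice_coeffCoact, hf]
  rfl

/-- The finite dual of the `V`-universal comeasuring algebra is the `V`-universal measuring
coalgebra. -/
theorem IsUniversalComeasuring.isUniversalMeasuring_coactFiniteDual
    (hV : IsPointwiseFiniteDimensional V) (hc : IsClosedInFiniteTopology V)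
    {Q : Type u} [Ring Q] [Algebra F Q] {ρ : A →ₗ[F] B ⊗[F] Q}
    (h : IsUniversalComeasuring ωA ωB V ρ) :
    IsUniversalMeasuring (C := finiteDual F Q) ωA ωB V (coactFiniteDual ρ) where
  isMeasuring := h.isComeasuring.isMeasuring_coactFiniteDual
  cosupport_le := by
    rintro _ ⟨f, rfl⟩
    convert coactCosupport_le_iff.1 h.cosupport_le f.1 using 1
    ext a
    simp [coactFiniteDual_tmul]
  existsUnique_hom := by
    intro P _ _ _ ψ hψ hle
    obtain ⟨ρ', hle', hρ'⟩ := exists_slice_convPairing_eq hV hc hle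
    have hsep : ∀ f g : WithConv (P →ₗ[F] F),
        (∀ p, convPairing F P p f = convPairing F P p g) → f = g :=
      fun f g h => WithConv.ext (LinearMap.ext h)
    -- The convolution algebra of `P` lies in the same universe as `P` and `F`, so it is an
    -- admissible test object.
    have hu := h.existsUnique_hom _ ρ'
      (isDualPairing_convPairing.isComeasuring hsep hρ' hψ) hle'
    obtain ⟨Φ, hΦ, -⟩ := id hu
    refine ⟨(isDualPairing_convPairing.comp_algHom Φ).toCoalgHom, ?_, fun φ hφ => ?_⟩
    · refine TensorProduct.ext' fun p a => ?_
      rw [hρ', ← hΦ, LinearMap.comp_apply, LinearMap.comp_apply, slice_lTensor]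
      exact coactFiniteDual_tmul ρ _ a
    -- Uniqueness by transposing back: a competing `φ` yields a homomorphism from `Q` to the
    -- convolution algebra that induces `ρ'`, hence equals `Φ`.
    · have he := isDualPairing_subtype.comp_coalgHom φ
      have hΦ' : he.toAlgHom.toLinearMap.lTensor B ∘ₗ ρ = ρ' := by
        refine LinearMap.ext fun a => ext_slice hsep fun p => ?_
        rw [← hρ', LinearMap.comp_apply, slice_lTensor, ← hφ]
        exact (coactFiniteDual_tmul ρ (φ p) a).symm
      ext p q
      exact congrArg (convPairing F P p) (DFunLike.congr_fun (hu.unique hΦ' hΦ) q)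

theorem rTensor_toLinearMap_comp {C D E : Type*} [AddCommGroup C] [Module F C] [Coalgebra F C]
    [AddCommGroup D] [Module F D] [Coalgebra F D] [AddCommGroup E] [Module F E] [Coalgebra F E]
    (θ : D →ₗc[F] E) (η : C →ₗc[F] D) : (θ.comp η).toLinearMap.rTensor A =
      θ.toLinearMap.rTensor A ∘ₗ η.toLinearMap.rTensor A :=
  LinearMap.rTensor_comp A θ.toLinearMap η.toLinearMap

/-- A morphism between `V`-universal measuring coalgebras is an isomorphism. -/
theorem IsUniversalMeasuring.exists_coalgEquiv {C D : Type u} [AddCommGroup C] [Module F C]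
    [Coalgebra F C] [AddCommGroup D] [Module F D] [Coalgebra F D]
    {ψ : C ⊗[F] A →ₗ[F] B} {ψ' : D ⊗[F] A →ₗ[F] B} (h : IsUniversalMeasuring ωA ωB V ψ)
    (h' : IsUniversalMeasuring ωA ωB V ψ') (θ : D →ₗc[F] C)
    (hθ : ψ ∘ₗ θ.toLinearMap.rTensor A = ψ') :
    ∃ e : D ≃ₗc[F] C, (e : D →ₗc[F] C) = θ := by
  obtain ⟨η, hη, -⟩ := h'.existsUnique_hom C ψ h.isMeasuring h.cosupport_le
  -- Both composites are endomorphisms of a terminal object.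
  have h₁ : θ.comp η = CoalgHom.id F C := by
    refine (h.existsUnique_hom C ψ h.isMeasuring h.cosupport_le).unique ?_ ?_
    · rw [rTensor_toLinearMap_comp, ← LinearMap.comp_assoc, hθ, hη]
    · exact congrArg (ψ ∘ₗ ·) (LinearMap.rTensor_id A C)
  have h₂ : η.comp θ = CoalgHom.id F D := by
    refine (h'.existsUnique_hom D ψ' h'.isMeasuring h'.cosupport_le).unique ?_ ?_
    · rw [rTensor_toLinearMap_comp, ← LinearMap.comp_assoc, hη, hθ]
    · exact congrArg (ψ' ∘ₗ ·) (LinearMap.rTensor_id A D)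
  exact ⟨CoalgEquiv.ofCoalgHom θ η h₁ h₂, CoalgEquiv.coe_ofCoalgHom θ η h₁ h₂⟩

end FiniteDualUniversal

end MeasDuality

end

theorem mainTheorem5 {F A B : Type u} [Field F] [AddCommGroup A] [Module F A]
    [AddCommGroup B] [Module F B] {Ω : Type v} {s t : Ω → ℕ}
    (ωA : OmegaStructure F s t A) (ωB : OmegaStructure F s t B)
    (V : Submodule F (A →ₗ[F] B)) (hfin : IsPointwiseFiniteDimensional V)
    (hclosed : IsClosedInFiniteTopology V) :
    (∃ (C : Type u) (_ : AddCommGroup C) (_ : Module F C) (_ : Coalgebra F C)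
      (ψ : C ⊗[F] A →ₗ[F] B), IsUniversalMeasuring ωA ωB V ψ) ∧
    (∃ (Q : Type u) (_ : Ring Q) (_ : Algebra F Q)
      (ρ : A →ₗ[F] B ⊗[F] Q), IsUniversalComeasuring ωA ωB V ρ) ∧
    ∀ (C : Type u) [AddCommGroup C] [Module F C] [Coalgebra F C] (ψ : C ⊗[F] A →ₗ[F] B)
      (Q : Type u) [Ring Q] [Algebra F Q] (ρ : A →ₗ[F] B ⊗[F] Q),
      IsUniversalMeasuring ωA ωB V ψ → IsUniversalComeasuring ωA ωB V ρ →
        (∃! θ : finiteDual F Q →ₗc[F] C,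
          ψ ∘ₗ θ.toLinearMap.rTensor A = coactFiniteDual ρ) ∧
        ∀ θ : finiteDual F Q →ₗc[F] C, ψ ∘ₗ θ.toLinearMap.rTensor A = coactFiniteDual ρ →
          ∃ e : finiteDual F Q ≃ₗc[F] C, (e : finiteDual F Q →ₗc[F] C) = θ := by
  have hQ := exists_isUniversalComeasuring ωA ωB hfin hclosed
  refine ⟨?_, hQ, fun C _ _ _ ψ Q _ _ ρ hψ hρ => ?_⟩
  -- Existence of the measuring coalgebra needs no separate construction: the finite dual serves.
  · obtain ⟨Q, _, _, ρ, hρ⟩ := hQ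
    exact ⟨finiteDual F Q, inferInstance, inferInstance, inferInstance, coactFiniteDual ρ,
      hρ.isUniversalMeasuring_coactFiniteDual hfin hclosed⟩
  · have h := hρ.isUniversalMeasuring_coactFiniteDual hfin hclosed
    exact ⟨hψ.existsUnique_hom _ _ h.isMeasuring h.cosupport_le,
      fun θ hθ => hψ.exists_coalgEquiv h θ hθ⟩
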